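/- Let $\Lambda$ be an Artin algebra (an algebra that is finitely generated as a module over a commutative Artinian ring), let $\operatorname{mod}\Lambda$ be the category of finitely generated right $\Lambda$-modules, and let $\operatorname{proj}\Lambda$ be its full subcategory of projective modules. All subcategories are full and closed under isomorphisms, and dimensions take values in $\{0,1,2,\dots,\infty\}$; the supremum defining a dimension counts the zero module as having projective dimension $0$. Let $\mathcal X\subseteq\operatorname{mod}\Lambda$ be - *resolving*: it contains $\operatorname{proj}\Lambda$ and is closed under extensions and under kernels of epimorphisms; and - *representation-finite*: it is closed under direct summands and has only finitely many isomorphism classes of indecomposable objects. For $A\in\operatorname{mod}\Lambda$ let $\operatorname{res.dim}_{\mathcal X}A$ be the least $n$ for which there is an exact sequence $0\to X_n\to\cdots\to X_0\to A\to 0$ with all $X_i\in\mathcal X$ ($\infty$ if there is none), and let $\operatorname{res.dim}_{\mathcal X}\operatorname{mod}\Lambda=\sup_{A\in\operatorname{mod}\Lambda}\operatorname{res.dim}_{\mathcal X}A$. For a ring $B$, let $\operatorname{gl.dim}B$ be the supremum of the projective dimensions of the right $B$-modules. Then $\mathcal X$ has a representation generator, that is, a module $T$ such that $\mathcal X=\operatorname{add}T$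 consists of the direct summands of finite direct sums of copies of $T$. For every such $T$, let $\mathsf A(\mathcal X)=\operatorname{End}_\Lambda(T)^{\mathrm{op}}$ be the Auslander algebra of $\mathcal X$, where products in $\operatorname{End}_\Lambda(T)$ are written in diagrammatic order (first factor applied first), so that each $\operatorname{Hom}_\Lambda(T,M)$ is a right $\mathsf A(\mathcal X)$-module by precomposition. Then: 1. $\operatorname{gl.dim}\mathsf A(\mathcal X)=0$ if and only if $\Lambda$ is semisimple, and in that case $\mathcal X=\operatorname{proj}\Lambda$. 2. $\operatorname{gl.dim}\mathsf A(\mathcal X)=1$ if and only if $\operatorname{gl.dim}\Lambda=1$ and $\mathcal X=\operatorname{proj}\Lambda$. 3. $\operatorname{gl.dim}\mathsf A(\mathcal X)=2$ if and only if either $\mathcal X=\operatorname{proj}\Lambda$ and $\operatorname{gl.dim}\Lambda=2$, or $\mathcal X\neq\operatorname{proj}\Lambda$ and $\operatorname{res.dim}_{\mathcal X}\operatorname{mod}\Lambda\le 2$. 4. If $\operatorname{res.dim}_{\mathcal X}\operatorname{mod}\Lambda\ge 3$, then $\operatorname{gl.dim}\mathsf A(\mathcal X)=\operatorname{res.dim}_{\mathcal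 X}\operatorname{mod}\Lambda$. In all cases, $$\operatorname{gl.dim}\mathsf A(\mathcal X)=\begin{cases}\operatorname{gl.dim}\Lambda & \text{if }\mathcal X=\operatorname{proj}\Lambda,\\ \max\{2,\operatorname{res.dim}_{\mathcal X}\operatorname{mod}\Lambda\} & \text{if }\mathcal X\neq\operatorname{proj}\Lambda.\end{cases}$$ -/

import Mathlib

open CategoryTheory

universe w u

namespace RelAuslander

/-! Left modules over a ring `S` are used in the general definitions. The category `mod Λ` of
finitely generated right `Λ`-modules is obtained for `S = Λᵐᵒᵖ`. -/

section Subcategories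

variable {S : Type u} [Ring S]

/-- The full subcategory of finitely generated projective modules. -/
def projFG (S : Type u) [Ring S] : ObjectProperty (ModuleCat.{u} S) :=
  fun M => Module.Finite S M ∧ Module.Projective S M

/-- A full subcategory of the category of finitely generated modules is resolving if it contains
the (finitely generated) projectives and is closed under extensions and under kernels of
epimorphisms. Full subcategories are closed under isomorphisms. -/
structure IsResolving (X : ObjectProperty (ModuleCat.{u} S)) : Prop where
  le_isFG : X ≤ ModuleCat.isFG.{u} S
  closedUnderIso : X.IsClosedUnderIsomorphisms
  proj_le : projFG S ≤ X
  extension : ∀ E : ShortComplex (ModuleCat.{u} S), E.ShortExact → X E.X₁ → X E.X₃ → X E.X₂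
  kernel : ∀ E : ShortComplex (ModuleCat.{u} S), E.ShortExact → X E.X₂ → X E.X₃ → X E.X₁

/-- `X` is of finite representation type (representation-finite): it is closed under direct
summands, which for a full subcategory of finitely generated modules over an Artin algebra says
that it is a Krull-Schmidt category, and it has only finitely many isomorphism classes of
indecomposable objects. -/
structure IsRepresentationFinite (X : ObjectProperty (ModuleCat.{u} S)) : Prop where
  closedUnderSummands : X.IsStableUnderRetracts
  finite_indecomposables : ∃ (n : ℕ) (M : Fin n → ModuleCat.{u} S),
    ∀ N : ModuleCat.{u} S, X N → Indecomposable N → ∃ i, Nonempty (N ≅ M i)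

/-- `add T`: the direct summands of finite direct sums of copies of `T`. -/
def addClosure (T : ModuleCat.{u} S) : ObjectProperty (ModuleCat.{u} S) :=
  fun M => ∃ n : ℕ, Nonempty (Retract M (ModuleCat.of S (Fin n → T)))

/-- `T` is a representation generator of `X`: `X = add T`. -/
def IsRepresentationGenerator (X : ObjectProperty (ModuleCat.{u} S)) (T : ModuleCat.{u} S) : Prop :=
  X = addClosure T

/-- `HasResolution X n A`: there is an exact sequence `0 → Xₙ → ⋯ → X₁ → X₀ → A → 0` with all
`Xᵢ` in `X`. The sequence is given through the short exact sequences into which it splits: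
`0 → K → X₀ → A → 0` together with a resolution `0 → Xₙ → ⋯ → X₁ → K → 0`. -/
def HasResolution (X : ObjectProperty (ModuleCat.{u} S)) : ℕ → ModuleCat.{u} S → Prop
  | 0, A => ∃ X₀ : ModuleCat.{u} S, X X₀ ∧ Nonempty (X₀ ≅ A)
  | n + 1, A => ∃ E : ShortComplex (ModuleCat.{u} S), E.ShortExact ∧ X E.X₂ ∧
      HasResolution X n E.X₁ ∧ Nonempty (E.X₃ ≅ A)

/-- The `X`-resolution dimension of a module `A`: the minimal length of a resolution of `A` by
objects of `X`, and `∞` if there is none. -/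
noncomputable def resDim (X : ObjectProperty (ModuleCat.{u} S)) (A : ModuleCat.{u} S) : ℕ∞ :=
  sInf {m : ℕ∞ | ∃ n : ℕ, m = n ∧ HasResolution X n A}

/-- The `X`-resolution dimension of the category of all finitely generated modules. -/
noncomputable def resDimMod (X : ObjectProperty (ModuleCat.{u} S)) : ℕ∞ :=
  ⨆ A : FGModuleCat.{u} S, resDim X A.obj

end Subcategories

/-- The (right) global dimension of a ring: the supremum of the projective dimensions of its right
modules. In Mathlib the zero module has projective dimension `⊥`; it contributes `0` here, so that
the zero ring has global dimension `0`. -/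
noncomputable def globalDim (A : Type u) [Ring A] : ℕ∞ :=
  ⨆ M : ModuleCat.{u} Aᵐᵒᵖ, (projectiveDimension M).unbotD 0

/-- The endomorphism ring of the right `Λ`-module `T`, whose product `f * g` is the map
`t ↦ f (g t)`. This is `End_Λ(T)ᵒᵖ` when products in `End_Λ(T)` are written in diagrammatic order
(first factor applied first). Its right modules are the contravariant additive functors on
`add T`; in particular each `Hom_Λ(T, M)` is a right module over it by precomposition. -/
abbrev AuslanderAlgebra {Λ : Type u} [Ring Λ] (T : ModuleCat.{u} Λᵐᵒᵖ) : Type u :=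
  Module.End Λᵐᵒᵖ T

end RelAuslander

/-!
Let `T` be a representation generator of the resolving subcategory `X`, let `S = Λᵐᵒᵖ` and let
`Γ = End(T)`. The functor `Hom(T, -)` from `S`-modules to right `Γ`-modules is left exact, and it
identifies `X = add T` with the finitely generated projective `Γ`-modules
(`projective_hom_of_addClosure`, `exists_homMap_eq`).

The central fact is `IsResolving.hasResolution_iff`: for finitely generated `M`, the projective
dimension of `Hom(T, M)` is the `X`-resolution dimension of `M`. Right approximations `Tᵐ → M`
give exact sequences `0 → K → Tᵐ → M → 0` that stay exact under `Hom(T, -)`, so both dimensions drop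
by one from `M` to `K`; for the resolution dimension this is `IsResolving.hasResolution_syzygy`,
which says that any `X`-syzygy may be used because `X` is resolving.

Every finitely generated `Γ`-module `F` is the cokernel of `Hom(T, f)` for some `f : Tᵃ → Tᵇ`, hence
has second syzygy `Hom(T, ker f)`, and `ker f` is a second `X`-syzygy of `coker f`. So if `X` has
resolution dimension at most `n + 2` on finitely generated modules then `F` has projective dimension
at most `n + 2`; conversely the global dimension of `Γ` bounds the resolution dimension through the
modules `Hom(T, M)`. If `Γ` has global dimension at most `1` then all objects of `X` are
projective, since the image of `Hom(T, Sᵏ) → Hom(T, M)` is projective for an epimorphism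
`Sᵏ → M` with `M ∈ X`. If `X` consists of projectives then `Hom(T, -)` is exact, `F` is isomorphic
to `Hom(T, coker f)`, and the global dimension of `Γ` is the resolution dimension, which is the
global dimension of `Λ`.

Throughout, global dimensions are tested on finitely generated modules
(`hasProjectiveDimensionLT_of_cyclic`, which follows from Baer's criterion by dimension shifting).
A representation generator exists because modules of finite length are direct sums of
indecomposable modules.
-/

namespace RelAuslander

/-! ### Global dimension and cyclic modules -/

section GlobalDim

open Abelian

theorem globalDim_le_iff (A : Type u) [Ring A] (n : ℕ) :
    globalDim A ≤ n ↔ ∀ M : ModuleCat.{u} Aᵐᵒᵖ, HasProjectiveDimensionLT M (n + 1) := by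
  rw [globalDim, iSup_le_iff]
  refine forall_congr' fun M => ?_
  rw [WithBot.unbotD_le_iff (by simp)]
  exact projectiveDimension_le_iff M n

variable {B : Type u} [Ring B]

/-- Baer's criterion in terms of `Ext`. -/
theorem injective_of_subsingleton_ext_cyclic (N : ModuleCat.{u} B)
    (h : ∀ I : Ideal B, Subsingleton (Ext (ModuleCat.of B (B ⧸ I)) N 1)) : Injective N := by
  have : Module.Injective B N := by
    refine Module.Baer.injective fun I g => ?_
    let E : ShortComplex (ModuleCat.{u} B) :=
      ShortComplex.mk (ModuleCat.ofHom I.subtype) (ModuleCat.ofHom I.mkQ) (by ext; simp)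
    have hE : E.ShortExact := ModuleCat.shortComplex_shortExact _
      (by simpa [E] using LinearMap.exact_subtype_mkQ I)
      I.injective_subtype I.mkQ_surjective
    obtain ⟨x, hx⟩ := Ext.contravariant_sequence_exact₁ hE N
      (Ext.mk₀ (ModuleCat.ofHom g : E.X₁ ⟶ N)) (n₁ := 1) (by omega) ((h I).elim _ _)
    obtain ⟨f, rfl⟩ := Ext.addEquiv₀.symm.surjective x
    rw [Ext.addEquiv₀_symm_apply, Ext.mk₀_comp_mk₀] at hx
    have hf := (Ext.mk₀_bijective _ _).1 hx
    exact ⟨f.hom, fun x hx => congr($hf ⟨x, hx⟩)⟩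
  exact Module.injective_object_of_injective_module B N

theorem hasInjectiveDimensionLT_of_subsingleton_ext_cyclic (n : ℕ) (N : ModuleCat.{u} B)
    (h : ∀ I : Ideal B, Subsingleton (Ext (ModuleCat.of B (B ⧸ I)) N (n + 1))) :
    HasInjectiveDimensionLT N (n + 1) := by
  induction n generalizing N with
  | zero =>
    have := injective_of_subsingleton_ext_cyclic N h
    infer_instance
  | succ n ih =>
    obtain ⟨J, _, f, _⟩ := EnoughInjectives.presentation N
    let E : ShortComplex (ModuleCat.{u} B) := ShortComplex.mk f (Limits.cokernel.π f) (by simp)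
    have hE : E.ShortExact := { exact := ShortComplex.exact_cokernel f }
    refine (hE.hasInjectiveDimensionLT_X₃_iff n ‹_›).1 (ih _ fun I => ⟨fun a b => ?_⟩)
    rw [← sub_eq_zero]
    obtain ⟨y, hy⟩ := Ext.covariant_sequence_exact₃ _ hE (a - b) rfl ((h I).elim _ _)
    rw [← hy, Ext.eq_zero_of_injective y, Ext.zero_comp]

/-- **Auslander's theorem**: bounds on projective dimensions may be tested on cyclic modules. -/
theorem hasProjectiveDimensionLT_of_cyclic (n : ℕ)
    (h : ∀ I : Ideal B, HasProjectiveDimensionLT (ModuleCat.of B (B ⧸ I)) (n + 1))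
    (M : ModuleCat.{u} B) : HasProjectiveDimensionLT M (n + 1) := by
  refine hasProjectiveDimensionLT_of_enoughInjectives M _ fun N => ?_
  have := hasInjectiveDimensionLT_of_subsingleton_ext_cyclic n N fun I =>
    HasProjectiveDimensionLT.subsingleton _ (n + 1) _ le_rfl _
  exact HasInjectiveDimensionLT.subsingleton _ (n + 1) _ le_rfl _

theorem globalDim_le_of_finite (A : Type u) [Ring A] (n : ℕ)
    (h : ∀ M : ModuleCat.{u} Aᵐᵒᵖ, Module.Finite Aᵐᵒᵖ M → HasProjectiveDimensionLT M (n + 1)) :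
    globalDim A ≤ n :=
  (globalDim_le_iff A n).2 <| hasProjectiveDimensionLT_of_cyclic n fun _ =>
    h _ (inferInstanceAs (Module.Finite Aᵐᵒᵖ (Aᵐᵒᵖ ⧸ _)))

end GlobalDim

/-! ### Resolutions by a resolving subcategory -/

section Resolutions

variable {S : Type u} [Ring S] {X : ObjectProperty (ModuleCat.{u} S)}
variable {L M N : Type u} [AddCommGroup L] [AddCommGroup M] [AddCommGroup N]
  [Module S L] [Module S M] [Module S N]

theorem IsResolving.of_equiv (hX : IsResolving X) (e : M ≃ₗ[S] N) (h : X (ModuleCat.of S M)) :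
    X (ModuleCat.of S N) :=
  have := hX.closedUnderIso
  X.prop_of_iso e.toModuleIso h

theorem IsResolving.ker (hX : IsResolving X) {f : M →ₗ[S] N} (hf : Function.Surjective f)
    (hM : X (ModuleCat.of S M)) (hN : X (ModuleCat.of S N)) :
    X (ModuleCat.of S (LinearMap.ker f)) :=
  hX.kernel _ (LinearMap.shortExact_shortComplexKer hf) hM hN

theorem IsResolving.prod (hX : IsResolving X) (hM : X (ModuleCat.of S M))
    (hN : X (ModuleCat.of S N)) : X (ModuleCat.of S (M × N)) :=
  hX.extension
    (ModuleCat.shortComplexOfCompEqZero (LinearMap.inl S M N) (LinearMap.snd S M N) (by ext; simp))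
    (ModuleCat.shortComplex_shortExact _ Function.Exact.inl_snd LinearMap.inl_injective
      LinearMap.snd_surjective) hM hN

theorem IsResolving.proj (hX : IsResolving X) [Module.Finite S M] [Module.Projective S M] :
    X (ModuleCat.of S M) :=
  hX.proj_le _ ⟨‹_›, ‹_›⟩

theorem IsResolving.pi (hX : IsResolving X) (n : ℕ) (F : Fin n → Type u)
    [∀ i, AddCommGroup (F i)] [∀ i, Module S (F i)] (h : ∀ i, X (ModuleCat.of S (F i))) :
    X (ModuleCat.of S (∀ i, F i)) := by
  induction n with
  | zero => exact hX.proj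
  | succ n ih =>
    exact hX.of_equiv (Fin.consLinearEquiv S F)
      (hX.prod (h 0) (ih (fun i => F i.succ) fun i => h _))

theorem hasResolution_of_iso {n : ℕ} {A B : ModuleCat.{u} S} (e : A ≅ B)
    (h : HasResolution X n A) : HasResolution X n B := by
  cases n with
  | zero => obtain ⟨Y, hY, ⟨i⟩⟩ := h; exact ⟨Y, hY, ⟨i ≪≫ e⟩⟩
  | succ n => obtain ⟨E, hE, h₂, h₁, ⟨i⟩⟩ := h; exact ⟨E, hE, h₂, h₁, ⟨i ≪≫ e⟩⟩

theorem hasResolution_of_equiv {n : ℕ} (e : M ≃ₗ[S] N)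
    (h : HasResolution X n (ModuleCat.of S M)) : HasResolution X n (ModuleCat.of S N) :=
  hasResolution_of_iso e.toModuleIso h

theorem IsResolving.hasResolution_zero_iff (hX : IsResolving X) {A : ModuleCat.{u} S} :
    HasResolution X 0 A ↔ X A := by
  have := hX.closedUnderIso
  exact ⟨fun ⟨_, hY, ⟨i⟩⟩ => X.prop_of_iso i hY, fun h => ⟨A, h, ⟨Iso.refl A⟩⟩⟩

theorem hasResolution_succ_of_surjective {n : ℕ} {f : M →ₗ[S] N} (hf : Function.Surjective f)
    (hM : X (ModuleCat.of S M)) (hK : HasResolution X n (ModuleCat.of S (LinearMap.ker f))) :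
    HasResolution X (n + 1) (ModuleCat.of S N) :=
  ⟨_, LinearMap.shortExact_shortComplexKer hf, hM, hK, ⟨Iso.refl _⟩⟩

theorem hasResolution_succ_iff {n : ℕ} :
    HasResolution X (n + 1) (ModuleCat.of S N) ↔ ∃ (M : ModuleCat.{u} S) (f : M →ₗ[S] N),
      Function.Surjective f ∧ X M ∧ HasResolution X n (ModuleCat.of S (LinearMap.ker f)) := by
  constructor
  · rintro ⟨E, hE, h₂, h₁, ⟨i⟩⟩
    refine ⟨E.X₂, i.toLinearEquiv.toLinearMap ∘ₗ E.g.hom,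
      i.toLinearEquiv.surjective.comp hE.moduleCat_surjective_g, h₂, ?_⟩
    rw [LinearMap.ker_comp_of_ker_eq_bot _ i.toLinearEquiv.ker]
    have hex := (ShortComplex.ShortExact.moduleCat_exact_iff_function_exact _).1 hE.exact
    rw [LinearMap.exact_iff.1 hex]
    exact hasResolution_of_equiv
      (LinearEquiv.ofInjective E.f.hom hE.moduleCat_injective_f) h₁
  · rintro ⟨M, f, hf, hM, hK⟩
    exact hasResolution_succ_of_surjective hf hM hK

/-- A kernel `ker g` with `g : M → N` epi and `N ∈ X` has a resolution as short as that of `M`. -/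
theorem IsResolving.hasResolution_ker (hX : IsResolving X) {n : ℕ} {g : M →ₗ[S] N}
    (hg : Function.Surjective g) (hN : X (ModuleCat.of S N))
    (hM : HasResolution X n (ModuleCat.of S M)) :
    HasResolution X n (ModuleCat.of S (LinearMap.ker g)) := by
  cases n with
  | zero =>
    rw [hX.hasResolution_zero_iff] at hM ⊢
    exact hX.ker hg hM hN
  | succ n =>
    obtain ⟨Y, f, hf, hY, hK⟩ := hasResolution_succ_iff.1 hM
    let f' : LinearMap.ker (g ∘ₗ f) →ₗ[S] LinearMap.ker g :=
      f.restrict fun y hy => hy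
    have hf' : Function.Surjective f' := by
      rintro ⟨m, hm⟩
      obtain ⟨y, rfl⟩ := hf m
      exact ⟨⟨y, hm⟩, rfl⟩
    refine hasResolution_succ_of_surjective hf' (hX.ker (hg.comp hf) hY hN) ?_
    refine hasResolution_of_equiv (M := LinearMap.ker f) ?_ hK
    exact
      { toFun := fun y => ⟨⟨y.1, by simp⟩, Subtype.ext y.2⟩
        invFun := fun y => ⟨y.1.1, congrArg Subtype.val y.2⟩
        map_add' := fun _ _ => rfl
        map_smul' := fun _ _ => rfl
        left_inv := fun _ => rfl
        right_inv := fun _ => rfl }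

/-- An extension of `N ∈ X` by a module has a resolution as short as that of the module. For the
inductive step, the first term of a resolution of the submodule is enlarged by a free module that
maps onto `N` with kernel in `X`. -/
theorem IsResolving.hasResolution_of_ker (hX : IsResolving X) {n : ℕ}
    {M N : Type u} [AddCommGroup M] [AddCommGroup N] [Module S M] [Module S N] {g : M →ₗ[S] N}
    (hg : Function.Surjective g) (hN : X (ModuleCat.of S N))
    (hK : HasResolution X n (ModuleCat.of S (LinearMap.ker g))) :
    HasResolution X n (ModuleCat.of S M) := by
  induction n generalizing M N with
  | zero =>
    rw [hX.hasResolution_zero_iff] at hK ⊢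
    exact hX.extension _ (LinearMap.shortExact_shortComplexKer hg) hK hN
  | succ n ih =>
    obtain ⟨Y, f, hf, hY, hL⟩ := hasResolution_succ_iff.1 hK
    have : Module.Finite S N := hX.le_isFG _ hN
    obtain ⟨k, p, hp⟩ := Module.Finite.exists_fin' S N
    obtain ⟨h, hh⟩ := Module.projective_lifting_property g p hg
    let φ : (Y × (Fin k → S)) →ₗ[S] M := ((LinearMap.ker g).subtype ∘ₗ f).coprod h
    have hgf : ∀ y, g (f y) = 0 := fun y => (f y).2
    have hgh : ∀ q, g (h q) = p q := fun q => congr($hh q)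
    have hφ : Function.Surjective φ := by
      intro m
      obtain ⟨q, hq⟩ := hp (g m)
      obtain ⟨y, hy⟩ := hf ⟨m - h q, by simp [hgh, hq]⟩
      exact ⟨(y, q), by simp [φ, hy]⟩
    refine hasResolution_succ_of_surjective hφ (hX.prod hY hX.proj) ?_
    let ψ : LinearMap.ker φ →ₗ[S] LinearMap.ker p :=
      (LinearMap.snd S Y (Fin k → S)).restrict (by
        rintro ⟨y, q⟩ hyq
        have := congrArg g (LinearMap.mem_ker.1 hyq)
        simpa [φ, hgf, hgh] using this)
    have hψ : Function.Surjective ψ := by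
      rintro ⟨q, hq⟩
      obtain ⟨y, hy⟩ := hf ⟨-h q, by simpa [hgh] using hq⟩
      exact ⟨⟨(y, q), by simp [φ, hy]⟩, rfl⟩
    refine ih hψ (hX.ker hp hX.proj hN) (hasResolution_of_equiv (M := LinearMap.ker f) ?_ hL)
    exact
      { toFun := fun y => ⟨⟨(y.1, 0), by simp [φ]⟩, rfl⟩
        invFun := fun y => ⟨y.1.1.1, by
          have h1 : (f y.1.1.1 : M) + h y.1.1.2 = 0 := y.1.2
          have h2 : y.1.1.2 = 0 := congrArg Subtype.val y.2
          simpa [h2] using h1⟩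
        map_add' := fun _ _ => by ext <;> simp
        map_smul' := fun _ _ => by ext <;> simp
        left_inv := fun _ => rfl
        right_inv := fun y => Subtype.ext <| Subtype.ext <|
          Prod.ext rfl (congrArg Subtype.val y.2).symm }

/-- The kernel of any epimorphism onto `N` from an object of `X` is a syzygy of `N` as good as
any other; compare two syzygies through the pullback. -/
theorem IsResolving.hasResolution_syzygy (hX : IsResolving X) {n : ℕ} {p : M →ₗ[S] N}
    (hp : Function.Surjective p) (hM : X (ModuleCat.of S M))
    (hN : HasResolution X (n + 1) (ModuleCat.of S N)) :
    HasResolution X n (ModuleCat.of S (LinearMap.ker p)) := by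
  obtain ⟨Y, f, hf, hY, hK⟩ := hasResolution_succ_iff.1 hN
  let P := LinearMap.ker (p ∘ₗ LinearMap.fst S M Y - f ∘ₗ LinearMap.snd S M Y)
  have hP : ∀ z : P, p z.1.1 = f z.1.2 := fun z => sub_eq_zero.1 z.2
  let a : P →ₗ[S] M := LinearMap.fst S M Y ∘ₗ P.subtype
  let b : P →ₗ[S] Y := LinearMap.snd S M Y ∘ₗ P.subtype
  have ha : Function.Surjective a := fun m =>
    let ⟨y, hy⟩ := hf (p m)
    ⟨⟨(m, y), by simp [P, hy]⟩, rfl⟩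
  have hb : Function.Surjective b := fun y =>
    let ⟨m, hm⟩ := hp (f y)
    ⟨⟨(m, y), by simp [P, hm]⟩, rfl⟩
  have eK : LinearMap.ker f ≃ₗ[S] LinearMap.ker a :=
    { toFun := fun y => ⟨⟨(0, y.1), by simp [P]⟩, rfl⟩
      invFun := fun z => ⟨z.1.1.2, by
        have h : z.1.1.1 = 0 := z.2
        simpa [h] using (hP z.1).symm⟩
      map_add' := fun _ _ => by ext <;> simp
      map_smul' := fun _ _ => by ext <;> simp
      left_inv := fun _ => rfl
      right_inv := fun z => Subtype.ext <| Subtype.ext <| Prod.ext (Eq.symm z.2) rfl }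
  have eL : LinearMap.ker b ≃ₗ[S] LinearMap.ker p :=
    { toFun := fun z => ⟨z.1.1.1, by
        have h : z.1.1.2 = 0 := z.2
        simpa [h] using hP z.1⟩
      invFun := fun m => ⟨⟨(m.1, 0), by simp [P]⟩, rfl⟩
      map_add' := fun _ _ => rfl
      map_smul' := fun _ _ => rfl
      left_inv := fun z => Subtype.ext <| Subtype.ext <| Prod.ext rfl (Eq.symm z.2)
      right_inv := fun _ => rfl }
  have hres : HasResolution X n (ModuleCat.of S P) :=
    hX.hasResolution_of_ker ha hM (hasResolution_of_equiv eK hK)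
  exact hasResolution_of_equiv eL (hX.hasResolution_ker hb hY hres)

end Resolutions

/-! ### The functor `Hom(T, -)` -/

section Hom

variable {S : Type u} [Ring S] {T : Type u} [AddCommGroup T] [Module S T]
variable {L M N : Type u} [AddCommGroup L] [AddCommGroup M] [AddCommGroup N]
  [Module S L] [Module S M] [Module S N]

/-- `Hom(T, M)` is a right module over `End(T)` by precomposition. -/
instance homModule : Module (Module.End S T)ᵐᵒᵖ (T →ₗ[S] M) where
  smul a f := f ∘ₗ a.unop
  one_smul _ := rfl
  mul_smul _ _ _ := rfl
  smul_zero _ := LinearMap.zero_comp _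
  smul_add _ _ _ := LinearMap.add_comp _ _ _
  add_smul _ _ _ := LinearMap.comp_add _ _ _
  zero_smul _ := LinearMap.comp_zero _

theorem end_op_smul_def (a : (Module.End S T)ᵐᵒᵖ) (f : T →ₗ[S] M) : a • f = f ∘ₗ a.unop := rfl

variable (T) in
/-- The map `Hom(T, M) → Hom(T, N)` of right `End(T)`-modules induced by `g : M → N`. -/
def homMap (g : M →ₗ[S] N) : (T →ₗ[S] M) →ₗ[(Module.End S T)ᵐᵒᵖ] (T →ₗ[S] N) where
  toFun f := g ∘ₗ f
  map_add' _ _ := LinearMap.comp_add _ _ _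
  map_smul' _ _ := rfl

@[simp]
theorem homMap_apply (g : M →ₗ[S] N) (f : T →ₗ[S] M) : homMap T g f = g ∘ₗ f := rfl

theorem homMap_comp (g : M →ₗ[S] N) (f : L →ₗ[S] M) :
    homMap T (g ∘ₗ f) = homMap T g ∘ₗ homMap T f := rfl

theorem homMap_id : homMap T (LinearMap.id : M →ₗ[S] M) = LinearMap.id := rfl

theorem homMap_subtype_injective (K : Submodule S M) :
    Function.Injective (homMap T K.subtype) :=
  fun _ _ h => LinearMap.ext fun t => Subtype.ext congr($h t)

theorem homMap_exact (g : M →ₗ[S] N) :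
    Function.Exact (homMap T (LinearMap.ker g).subtype) (homMap T g) := by
  intro f
  constructor
  · intro h
    exact ⟨f.codRestrict _ fun t => congr($h t), rfl⟩
  · rintro ⟨f, rfl⟩
    ext t
    exact (f t).2

/-- The right `End(T)`-linear map `Hom(T, Tⁿ) → F` determined by elements `q₁, …, qₙ` of `F`. -/
def homPiLift {F : Type u} [AddCommGroup F] [Module (Module.End S T)ᵐᵒᵖ F] {n : ℕ}
    (q : Fin n → F) : (T →ₗ[S] (Fin n → T)) →ₗ[(Module.End S T)ᵐᵒᵖ] F where
  toFun h := ∑ j, MulOpposite.op (LinearMap.proj j ∘ₗ h : Module.End S T) • q j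
  map_add' f g := by
    simp only [LinearMap.comp_add, MulOpposite.op_add, add_smul, Finset.sum_add_distrib]
  map_smul' a f := by
    simp only [RingHom.id_apply, Finset.smul_sum, ← mul_smul]
    rfl

theorem homPiLift_single {F : Type u} [AddCommGroup F] [Module (Module.End S T)ᵐᵒᵖ F] {n : ℕ}
    (q : Fin n → F) (j : Fin n) :
    homPiLift (S := S) (T := T) q (LinearMap.single S (fun _ => T) j) = q j := by
  change ∑ i, MulOpposite.op (LinearMap.proj i ∘ₗ LinearMap.single S (fun _ : Fin n => T) j :
    Module.End S T) • q i = _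
  rw [Finset.sum_eq_single j]
  · rw [LinearMap.proj_comp_single_same]
    exact one_smul _ _
  · intro i _ hij
    rw [LinearMap.proj_comp_single_ne _ _ _ _ hij]
    exact zero_smul _ _
  · simp

theorem homPiLift_unique {F : Type u} [AddCommGroup F] [Module (Module.End S T)ᵐᵒᵖ F] {n : ℕ}
    (φ : (T →ₗ[S] (Fin n → T)) →ₗ[(Module.End S T)ᵐᵒᵖ] F) :
    φ = homPiLift fun j => φ (LinearMap.single S (fun _ => T) j) := by
  ext h
  have hh : h = ∑ j, MulOpposite.op (LinearMap.proj j ∘ₗ h : Module.End S T) •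
      LinearMap.single S (fun _ : Fin n => T) j := by
    ext t i
    simp [end_op_smul_def, LinearMap.sum_apply, Pi.single_apply]
  conv_lhs => rw [hh]
  rw [map_sum]
  simp only [map_smul]
  rfl

theorem projective_hom_pi (n : ℕ) :
    Module.Projective (Module.End S T)ᵐᵒᵖ (T →ₗ[S] (Fin n → T)) := by
  refine .of_lifting_property'' fun f hf => ?_
  choose q hq using fun j => hf (LinearMap.single S (fun _ => T) j)
  refine ⟨homPiLift q, ?_⟩
  rw [homPiLift_unique (f ∘ₗ homPiLift q),
    homPiLift_unique (LinearMap.id (M := T →ₗ[S] (Fin n → T)))]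
  simp [homPiLift_single, hq]

theorem exists_homMap_eq_of_pi {n : ℕ}
    (φ : (T →ₗ[S] (Fin n → T)) →ₗ[(Module.End S T)ᵐᵒᵖ] (T →ₗ[S] M)) :
    ∃ g : (Fin n → T) →ₗ[S] M, φ = homMap T g := by
  refine ⟨∑ j, φ (LinearMap.single S (fun _ => T) j) ∘ₗ LinearMap.proj j, ?_⟩
  refine (homPiLift_unique φ).trans (.trans ?_ (homPiLift_unique (homMap T _)).symm)
  congr 1
  ext j t
  simp [Pi.single_apply, apply_ite]

/-- Every finitely generated right `End(T)`-module is a quotient of some `Hom(T, Tⁿ)`. -/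
theorem exists_surjective_hom_pi (F : Type u) [AddCommGroup F] [Module (Module.End S T)ᵐᵒᵖ F]
    [Module.Finite (Module.End S T)ᵐᵒᵖ F] :
    ∃ (n : ℕ) (φ : (T →ₗ[S] (Fin n → T)) →ₗ[(Module.End S T)ᵐᵒᵖ] F), Function.Surjective φ := by
  obtain ⟨n, q, hq⟩ := Module.Finite.exists_fin (R := (Module.End S T)ᵐᵒᵖ) (M := F)
  refine ⟨n, homPiLift q, LinearMap.range_eq_top.1 (top_le_iff.1 ?_)⟩
  rw [← hq, Submodule.span_le]
  rintro _ ⟨j, rfl⟩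
  exact ⟨_, homPiLift_single q j⟩

variable (S T) in
/-- `T` generates the category of modules, in the strong form that the regular module is a direct
summand of some `Tⁿ`. -/
def IsGenerator : Prop :=
  ∃ (n : ℕ) (i : S →ₗ[S] (Fin n → T)) (r : (Fin n → T) →ₗ[S] S), r ∘ₗ i = LinearMap.id

theorem IsGenerator.surjective (hT : IsGenerator S T) {f : M →ₗ[S] N}
    (hf : Function.Surjective (homMap T f)) : Function.Surjective f := by
  obtain ⟨n, i, r, hri⟩ := hT
  intro x
  choose c hc using fun j : Fin n =>
    hf (LinearMap.toSpanSingleton S N x ∘ₗ r ∘ₗ LinearMap.single S (fun _ => T) j)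
  have h : f ∘ₗ LinearMap.lsum S (fun _ => T) ℕ c = LinearMap.toSpanSingleton S N x ∘ₗ r := by
    refine LinearMap.pi_ext' fun j => ?_
    rw [LinearMap.comp_assoc, LinearMap.comp_assoc, ← hc j]
    ext t
    simp [Pi.single_apply, apply_ite]
  refine ⟨_, (congr($h (i 1))).trans ?_⟩
  have h1 : r (i 1) = 1 := congr($hri 1)
  simp [h1]

theorem IsGenerator.ext (hT : IsGenerator S T) {f g : M →ₗ[S] N}
    (h : ∀ t : T →ₗ[S] M, f ∘ₗ t = g ∘ₗ t) : f = g := by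
  obtain ⟨n, i, r, hri⟩ := hT
  ext x
  have h2 : f ∘ₗ LinearMap.toSpanSingleton S M x ∘ₗ r =
      g ∘ₗ LinearMap.toSpanSingleton S M x ∘ₗ r :=
    LinearMap.pi_ext' fun j =>
      h (LinearMap.toSpanSingleton S M x ∘ₗ r ∘ₗ LinearMap.single S (fun _ => T) j)
  have h1 : r (i 1) = 1 := congr($hri 1)
  simpa [h1] using congr($h2 (i 1))

theorem addClosure_iff {T : ModuleCat.{u} S} :
    addClosure T (ModuleCat.of S M) ↔ ∃ (n : ℕ) (i : M →ₗ[S] (Fin n → T))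
      (r : (Fin n → T) →ₗ[S] M), r ∘ₗ i = LinearMap.id := by
  constructor
  · rintro ⟨n, ⟨h⟩⟩
    exact ⟨n, h.i.hom, h.r.hom, congrArg ModuleCat.Hom.hom h.retract⟩
  · rintro ⟨n, i, r, h⟩
    exact ⟨n, ⟨⟨ModuleCat.ofHom i, ModuleCat.ofHom r, by ext x; exact congr($h x)⟩⟩⟩

theorem projective_hom_of_addClosure {T : ModuleCat.{u} S}
    (hM : addClosure T (ModuleCat.of S M)) :
    Module.Projective (Module.End S T)ᵐᵒᵖ (T →ₗ[S] M) := by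
  obtain ⟨n, i, r, h⟩ := addClosure_iff.1 hM
  have := projective_hom_pi (S := S) (T := T) n
  exact .of_split (homMap T i) (homMap T r) (by rw [← homMap_comp, h, homMap_id])

theorem exists_homMap_eq {T : ModuleCat.{u} S} (hM : addClosure T (ModuleCat.of S M))
    (φ : (T →ₗ[S] M) →ₗ[(Module.End S T)ᵐᵒᵖ] (T →ₗ[S] N)) :
    ∃ g : M →ₗ[S] N, φ = homMap T g := by
  obtain ⟨n, i, r, h⟩ := addClosure_iff.1 hM
  obtain ⟨g, hg⟩ := exists_homMap_eq_of_pi (φ ∘ₗ homMap T r)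
  refine ⟨g ∘ₗ i, ?_⟩
  rw [homMap_comp, ← hg, LinearMap.comp_assoc, ← homMap_comp, h, homMap_id, LinearMap.comp_id]

variable (S T) in
/-- `Hom(T, M)` is a noetherian right `End(T)`-module for each finitely generated `M`. It provides
right `add T`-approximations and finite presentations by modules `Hom(T, Tⁿ)`. -/
def IsHomNoetherian : Prop :=
  ∀ (M : Type u) [AddCommGroup M] [Module S M], Module.Finite S M →
    IsNoetherian (Module.End S T)ᵐᵒᵖ (T →ₗ[S] M)

theorem isHomNoetherian_of_algebra (R : Type w) [CommRing R] [IsNoetherianRing R] [Algebra R S]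
    [Module.Finite R S] [Module.Finite S T] : IsHomNoetherian S T := by
  intro M _ _ _
  let : Module R T := Module.compHom T (algebraMap R S)
  let : Module R M := Module.compHom M (algebraMap R S)
  have : IsScalarTower R S T := .of_algebraMap_smul fun _ _ => rfl
  have : IsScalarTower R S M := .of_algebraMap_smul fun _ _ => rfl
  have : Module.Finite R M := .trans S M
  obtain ⟨k, t, ht⟩ := Module.Finite.exists_fin (R := S) (M := T)
  let ev : (T →ₗ[S] M) →ₗ[R] (Fin k → M) := LinearMap.pi fun j => LinearMap.applyₗ' R (t j)
  have hev : Function.Injective ev := fun f g h =>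
    LinearMap.ext_on_range ht fun j => congrFun h j
  have : IsNoetherian R (T →ₗ[S] M) := isNoetherian_of_injective ev hev
  have : IsScalarTower R (Module.End S T)ᵐᵒᵖ (T →ₗ[S] M) :=
    ⟨fun r a f => LinearMap.ext fun x => by simp [end_op_smul_def]⟩
  exact isNoetherian_of_tower R ‹_›

/-- Every finitely generated module has a right `add T`-approximation. -/
theorem IsHomNoetherian.exists_approximation (hT : IsHomNoetherian S T) [Module.Finite S M] :
    ∃ (n : ℕ) (p : (Fin n → T) →ₗ[S] M), Function.Surjective (homMap T p) := by
  have := hT M ‹_›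
  obtain ⟨n, φ, hφ⟩ := exists_surjective_hom_pi (S := S) (T := T) (T →ₗ[S] M)
  obtain ⟨g, rfl⟩ := exists_homMap_eq_of_pi φ
  exact ⟨n, g, hφ⟩

/-- Every finitely generated right `End(T)`-module is presented by a map `Tᵃ → Tᵇ`. -/
theorem IsHomNoetherian.exists_presentation (hT : IsHomNoetherian S T) [Module.Finite S T]
    (F : Type u) [AddCommGroup F] [Module (Module.End S T)ᵐᵒᵖ F]
    [Module.Finite (Module.End S T)ᵐᵒᵖ F] :
    ∃ (a b : ℕ) (f : (Fin a → T) →ₗ[S] (Fin b → T))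
      (q : (T →ₗ[S] (Fin b → T)) →ₗ[(Module.End S T)ᵐᵒᵖ] F),
      Function.Surjective q ∧ LinearMap.ker q = LinearMap.range (homMap T f) := by
  obtain ⟨b, q, hq⟩ := exists_surjective_hom_pi (S := S) (T := T) F
  have := hT (Fin b → T) inferInstance
  obtain ⟨a, φ, hφ⟩ := exists_surjective_hom_pi (S := S) (T := T) (LinearMap.ker q)
  obtain ⟨f, hf⟩ := exists_homMap_eq_of_pi ((LinearMap.ker q).subtype ∘ₗ φ)
  refine ⟨a, b, f, q, hq, ?_⟩
  rw [← hf, LinearMap.range_comp, LinearMap.range_eq_top.2 hφ, Submodule.map_top,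
    Submodule.range_subtype]

end Hom

/-! ### Resolutions and projective dimensions over the Auslander algebra -/

section Comparison

variable {S : Type u} [Ring S]

section ProjectiveDimension

variable {L M N : Type u} [AddCommGroup L] [AddCommGroup M] [AddCommGroup N]
  [Module S L] [Module S M] [Module S N]

theorem hasProjectiveDimensionLT_one_iff :
    HasProjectiveDimensionLT (ModuleCat.of S M) 1 ↔ Module.Projective S M := by
  rw [← projective_iff_hasProjectiveDimensionLT_one, IsProjective.iff_projective]

theorem hasProjectiveDimensionLT_succ_iff_of_exact (n : ℕ) {f : L →ₗ[S] M} {g : M →ₗ[S] N}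
    (hM : Module.Projective S M) (hf : Function.Injective f) (hfg : Function.Exact f g)
    (hg : Function.Surjective g) :
    HasProjectiveDimensionLT (ModuleCat.of S N) (n + 2) ↔
      HasProjectiveDimensionLT (ModuleCat.of S L) (n + 1) :=
  (ModuleCat.shortComplex_shortExact
    (ModuleCat.shortComplexOfCompEqZero f g hfg.linearMap_comp_eq_zero) hfg hf
      hg).hasProjectiveDimensionLT_X₃_iff n ((IsProjective.iff_projective M).1 hM)

theorem hasProjectiveDimensionLT_of_equiv {n : ℕ} (e : M ≃ₗ[S] N)
    (h : HasProjectiveDimensionLT (ModuleCat.of S M) n) :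
    HasProjectiveDimensionLT (ModuleCat.of S N) n :=
  hasProjectiveDimensionLT_of_iso e.toModuleIso n

/-- An endomorphism `e` that vanishes on the kernel of an epimorphism `p` with `p ∘ e = p` gives a
section of `p`. -/
theorem exists_section_of_comp_eq {p : M →ₗ[S] N} {e : M →ₗ[S] M} (hp : Function.Surjective p)
    (hpe : p ∘ₗ e = p) (hek : e ∘ₗ (LinearMap.ker p).subtype = 0) :
    ∃ q : N →ₗ[S] M, p ∘ₗ q = LinearMap.id := by
  let q : N →ₗ[S] M := (LinearMap.ker p).liftQ e (fun x hx => congr($hek ⟨x, hx⟩)) ∘ₗ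
    (p.quotKerEquivOfSurjective hp).symm.toLinearMap
  have hq : q ∘ₗ p = e := by
    ext1 x
    simp [q, LinearMap.quotKerEquivOfSurjective_symm_apply]
  refine ⟨q, ?_⟩
  rw [← LinearMap.cancel_right hp, LinearMap.comp_assoc, hq, hpe, LinearMap.id_comp]

/-- Over a noetherian ring, resolutions by finitely generated projectives compute projective
dimensions. -/
theorem hasResolution_projFG_iff [IsNoetherianRing S] (n : ℕ) {M : Type u} [AddCommGroup M]
    [Module S M] [Module.Finite S M] :
    HasResolution (projFG S) n (ModuleCat.of S M) ↔
      HasProjectiveDimensionLT (ModuleCat.of S M) (n + 1) := by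
  induction n generalizing M with
  | zero =>
    rw [zero_add, hasProjectiveDimensionLT_one_iff]
    refine ⟨fun ⟨Y, ⟨_, hY⟩, ⟨i⟩⟩ => ?_, fun h => ⟨_, ⟨‹_›, h⟩, ⟨Iso.refl _⟩⟩⟩
    exact Module.Projective.of_equiv i.toLinearEquiv
  | succ n ih =>
    constructor
    · intro h
      obtain ⟨Y, f, hf, ⟨_, hY⟩, hK⟩ := hasResolution_succ_iff.1 h
      exact (hasProjectiveDimensionLT_succ_iff_of_exact n hY (Submodule.subtype_injective _)
        f.exact_subtype_ker_map hf).2 (ih.1 hK)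
    · intro h
      obtain ⟨k, p, hp⟩ := Module.Finite.exists_fin' S M
      refine hasResolution_succ_of_surjective hp ⟨inferInstance, inferInstance⟩ (ih.2 ?_)
      exact (hasProjectiveDimensionLT_succ_iff_of_exact n inferInstance
        (Submodule.subtype_injective _) p.exact_subtype_ker_map hp).1 h

end ProjectiveDimension

variable {X : ObjectProperty (ModuleCat.{u} S)} {T : ModuleCat.{u} S}

theorem IsRepresentationGenerator.pi (hT : IsRepresentationGenerator X T) (n : ℕ) :
    X (ModuleCat.of S (Fin n → T)) := by
  rw [hT]
  exact ⟨n, ⟨Retract.refl _⟩⟩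

theorem IsRepresentationGenerator.finite (hT : IsRepresentationGenerator X T)
    (hX : IsResolving X) : Module.Finite S T :=
  have : Module.Finite S (Fin 1 → T) := hX.le_isFG _ (hT.pi 1)
  .equiv (LinearEquiv.funUnique (Fin 1) S T)

theorem IsRepresentationGenerator.isGenerator (hT : IsRepresentationGenerator X T)
    (hX : IsResolving X) : IsGenerator S T := by
  have h : X (ModuleCat.of S S) := hX.proj
  rw [hT] at h
  exact addClosure_iff.1 h

/-- For `X = add T` resolving, `M` has an `X`-resolution of length `n` if and only if the projective
dimension of `Hom(T, M)` is at most `n`. A right approximation `Tᵐ → M` gives the first step of a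
resolution on either side. -/
theorem IsResolving.hasResolution_iff (hX : IsResolving X) (hT : IsRepresentationGenerator X T)
    [IsNoetherianRing S] (hN : IsHomNoetherian S T) (n : ℕ) {M : Type u} [AddCommGroup M]
    [Module S M] [Module.Finite S M] :
    HasResolution X n (ModuleCat.of S M) ↔
      HasProjectiveDimensionLT (ModuleCat.of (Module.End S T)ᵐᵒᵖ (T →ₗ[S] M)) (n + 1) := by
  have := hT.finite hX
  induction n generalizing M with
  | zero =>
    rw [hX.hasResolution_zero_iff, zero_add, hasProjectiveDimensionLT_one_iff]
    refine ⟨fun h => projective_hom_of_addClosure (hT ▸ h), fun h => ?_⟩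
    obtain ⟨m, p, hp⟩ := hN.exists_approximation (M := M)
    have hp' := (hT.isGenerator hX).surjective hp
    obtain ⟨s, hs⟩ := Module.projective_lifting_property (homMap T p) LinearMap.id hp
    -- the idempotent `s ∘ Hom(T, p)` comes from an endomorphism of `Tᵐ` that factors through `M`
    obtain ⟨e, he⟩ := exists_homMap_eq_of_pi (s ∘ₗ homMap T p)
    have hpe : p ∘ₗ e = p := (hT.isGenerator hX).ext fun t => by
      have h1 : s (p ∘ₗ t) = e ∘ₗ t := congr($he t)
      have h2 : p ∘ₗ s (p ∘ₗ t) = p ∘ₗ t := congr($hs (p ∘ₗ t))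
      rw [LinearMap.comp_assoc, ← h1, h2]
    have hek : e ∘ₗ (LinearMap.ker p).subtype = 0 := (hT.isGenerator hX).ext fun t => by
      have h1 : s (p ∘ₗ (LinearMap.ker p).subtype ∘ₗ t) = e ∘ₗ (LinearMap.ker p).subtype ∘ₗ t :=
        congr($he ((LinearMap.ker p).subtype ∘ₗ t))
      rw [LinearMap.comp_assoc, ← h1, ← LinearMap.comp_assoc, LinearMap.comp_ker_subtype,
        LinearMap.zero_comp, map_zero, LinearMap.zero_comp]
    obtain ⟨q, hq⟩ := exists_section_of_comp_eq hp' hpe hek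
    rw [hT]
    exact addClosure_iff.2 ⟨m, q, p, hq⟩
  | succ n ih =>
    obtain ⟨m, p, hp⟩ := hN.exists_approximation (M := M)
    have hp' := (hT.isGenerator hX).surjective hp
    rw [hasProjectiveDimensionLT_succ_iff_of_exact n (projective_hom_pi m)
      (homMap_subtype_injective _) (homMap_exact p) hp]
    refine Iff.trans ?_ (ih (M := LinearMap.ker p))
    exact ⟨hX.hasResolution_syzygy hp' (hT.pi m),
      hasResolution_succ_of_surjective hp' (hT.pi m)⟩

/-- If all finitely generated modules have `X`-resolutions of length `n + 2`, then all finitely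
generated modules over the Auslander algebra have projective dimension at most `n + 2`: the second
syzygy of such a module has the form `Hom(T, K)` with `K` a second syzygy relative to `X`. -/
theorem IsResolving.hasProjectiveDimensionLT_add_three (hX : IsResolving X)
    (hT : IsRepresentationGenerator X T) [IsNoetherianRing S] (hN : IsHomNoetherian S T) (n : ℕ)
    (h : ∀ (M : Type u) [AddCommGroup M] [Module S M], Module.Finite S M →
      HasResolution X (n + 2) (ModuleCat.of S M))
    (F : ModuleCat.{u} (Module.End S T)ᵐᵒᵖ) [Module.Finite (Module.End S T)ᵐᵒᵖ F] :
    HasProjectiveDimensionLT F (n + 3) := by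
  have := hT.finite hX
  obtain ⟨a, b, f, q, hq, hf⟩ := hN.exists_presentation F
  have h1 : HasResolution X (n + 1) (ModuleCat.of S (LinearMap.range f)) := by
    have := hX.hasResolution_syzygy (LinearMap.range f).mkQ_surjective (hT.pi b)
      (h (_ ⧸ LinearMap.range f) inferInstance)
    rwa [Submodule.ker_mkQ] at this
  have h2 := hX.hasResolution_syzygy f.surjective_rangeRestrict (hT.pi a) h1
  rw [LinearMap.ker_rangeRestrict, hX.hasResolution_iff hT hN] at h2
  refine (hasProjectiveDimensionLT_succ_iff_of_exact (n + 1) (projective_hom_pi b)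
    (Submodule.subtype_injective _) q.exact_subtype_ker_map hq).2 ?_
  rw [hf]
  refine (hasProjectiveDimensionLT_succ_iff_of_exact n (projective_hom_pi a)
    (homMap_subtype_injective (LinearMap.ker f)) (g := (homMap T f).rangeRestrict) ?_
    (LinearMap.surjective_rangeRestrict _)).2 h2
  rw [LinearMap.exact_iff, LinearMap.ker_rangeRestrict, ← LinearMap.exact_iff]
  exact homMap_exact f

/-- If `T` is projective then each finitely generated module over the Auslander algebra is of the
form `Hom(T, C)`, and resolutions of `C` compute its projective dimension. -/
theorem IsResolving.hasProjectiveDimensionLT_of_projective (hX : IsResolving X)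
    (hT : IsRepresentationGenerator X T) [Module.Projective S T] [IsNoetherianRing S]
    (hN : IsHomNoetherian S T) (n : ℕ)
    (h : ∀ (M : Type u) [AddCommGroup M] [Module S M], Module.Finite S M →
      HasResolution X n (ModuleCat.of S M))
    (F : ModuleCat.{u} (Module.End S T)ᵐᵒᵖ) [Module.Finite (Module.End S T)ᵐᵒᵖ F] :
    HasProjectiveDimensionLT F (n + 1) := by
  have := hT.finite hX
  obtain ⟨a, b, f, q, hq, hf⟩ := hN.exists_presentation F
  have hπ : Function.Surjective (homMap T (LinearMap.range f).mkQ) := fun g =>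
    Module.projective_lifting_property _ g (LinearMap.range f).mkQ_surjective
  have hker : LinearMap.ker (homMap T (LinearMap.range f).mkQ) = LinearMap.ker q := by
    rw [hf]
    refine le_antisymm (fun g hg => ?_) ?_
    · have hg' : ∀ t, g t ∈ LinearMap.range f := fun t =>
        (Submodule.Quotient.mk_eq_zero _).1 congr($hg t)
      obtain ⟨g', hg'⟩ := Module.projective_lifting_property f.rangeRestrict
        (g.codRestrict _ hg') f.surjective_rangeRestrict
      exact ⟨g', LinearMap.ext fun t => congrArg Subtype.val congr($hg' t)⟩
    · rintro _ ⟨g, rfl⟩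
      ext t
      simp
  have e := ((homMap T (LinearMap.range f).mkQ).quotKerEquivOfSurjective hπ).symm ≪≫ₗ
    Submodule.quotEquivOfEq _ _ hker ≪≫ₗ q.quotKerEquivOfSurjective hq
  exact hasProjectiveDimensionLT_of_equiv e
    ((hX.hasResolution_iff hT hN n).1 (h _ inferInstance))

/-- If the Auslander algebra is hereditary, then `X` consists of projective modules: for an
epimorphism `p : Sᵏ → M` with `M ∈ X`, the image of `Hom(T, Sᵏ) → Hom(T, M)` is projective, so
the kernel of `p` splits off. -/
theorem IsResolving.projective_of_hasProjectiveDimensionLT_two (hX : IsResolving X)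
    (hT : IsRepresentationGenerator X T)
    (h : ∀ F : ModuleCat.{u} (Module.End S T)ᵐᵒᵖ, HasProjectiveDimensionLT F 2)
    {M : Type u} [AddCommGroup M] [Module S M] (hM : X (ModuleCat.of S M)) :
    Module.Projective S M := by
  have : Module.Finite S M := hX.le_isFG _ hM
  obtain ⟨k, p, hp⟩ := Module.Finite.exists_fin' S M
  have hS : addClosure T (ModuleCat.of S (Fin k → S)) := hT ▸ hX.proj
  have hI : Module.Projective (Module.End S T)ᵐᵒᵖ (LinearMap.range (homMap T p)) :=
    hasProjectiveDimensionLT_one_iff.1 <| (hasProjectiveDimensionLT_succ_iff_of_exact 0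
      (projective_hom_of_addClosure (hT ▸ hM)) (Submodule.subtype_injective _)
      (LinearMap.exact_subtype_mkQ _) (Submodule.mkQ_surjective _)).1 (h _)
  obtain ⟨σ, hσ⟩ := Module.projective_lifting_property (homMap T p).rangeRestrict LinearMap.id
    (LinearMap.surjective_rangeRestrict _)
  -- by fullness on `add T`, a section over the image yields an idempotent endomorphism of `Sᵏ`
  -- that factors through `M`
  obtain ⟨e, he⟩ := exists_homMap_eq hS (σ ∘ₗ (homMap T p).rangeRestrict)
  have hpe : p ∘ₗ e = p := (hT.isGenerator hX).ext fun t => by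
    have h1 : σ ((homMap T p).rangeRestrict t) = e ∘ₗ t := congr($he t)
    have h2 : p ∘ₗ σ ((homMap T p).rangeRestrict t) = p ∘ₗ t :=
      congrArg Subtype.val congr($hσ ((homMap T p).rangeRestrict t))
    rw [LinearMap.comp_assoc, ← h1, h2]
  have hek : e ∘ₗ (LinearMap.ker p).subtype = 0 := (hT.isGenerator hX).ext fun t => by
    have h1 : σ ((homMap T p).rangeRestrict ((LinearMap.ker p).subtype ∘ₗ t)) =
      e ∘ₗ (LinearMap.ker p).subtype ∘ₗ t := congr($he ((LinearMap.ker p).subtype ∘ₗ t))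
    have h2 : (homMap T p).rangeRestrict ((LinearMap.ker p).subtype ∘ₗ t) = 0 :=
      Subtype.ext (by ext; simp)
    rw [LinearMap.comp_assoc, ← h1, h2, map_zero, LinearMap.zero_comp]
  obtain ⟨q, hq⟩ := exists_section_of_comp_eq hp hpe hek
  exact .of_split q p hq

end Comparison

/-! ### Representation generators -/

section Generators

variable {S : Type u} [Ring S]

theorem addClosure_prod {T : ModuleCat.{u} S} {M N : Type u} [AddCommGroup M] [AddCommGroup N]
    [Module S M] [Module S N] (hM : addClosure T (ModuleCat.of S M))
    (hN : addClosure T (ModuleCat.of S N)) : addClosure T (ModuleCat.of S (M × N)) := by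
  obtain ⟨m, i, r, h⟩ := addClosure_iff.1 hM
  obtain ⟨n, j, s, h'⟩ := addClosure_iff.1 hN
  let e : (Fin (m + n) → T) ≃ₗ[S] (Fin m → T) × (Fin n → T) :=
    LinearEquiv.funCongrLeft S T finSumFinEquiv ≪≫ₗ LinearEquiv.sumArrowLequivProdArrow _ _ S T
  refine addClosure_iff.2 ⟨m + n, e.symm.toLinearMap ∘ₗ i.prodMap j,
    r.prodMap s ∘ₗ e.toLinearMap, ?_⟩
  refine LinearMap.ext fun x => Prod.ext ?_ ?_
  · simpa using congr($h x.1)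
  · simpa using congr($h' x.2)

theorem addClosure_of_iso {T A B : ModuleCat.{u} S} (e : A ≅ B) (h : addClosure T A) :
    addClosure T B := by
  obtain ⟨n, ⟨r⟩⟩ := h
  exact ⟨n, ⟨e.symm.retract.trans r⟩⟩

/-- If `X` is closed under direct summands and consists of modules of finite length, then `X`
is contained in `add T` as soon as the indecomposables of `X` are. -/
theorem le_addClosure_of_indecomposable {X : ObjectProperty (ModuleCat.{u} S)}
    (hX : X.IsStableUnderRetracts) (hl : ∀ M, X M → Module.length S M ≠ ⊤) {T : ModuleCat.{u} S}
    (hT : ∀ M, X M → Indecomposable M → addClosure T M) : X ≤ addClosure T := by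
  have key : ∀ (n : ℕ) (M : ModuleCat.{u} S), X M → Module.length S M ≤ n → addClosure T M := by
    intro n
    induction n with
    | zero =>
      intro M _ hn
      have : Subsingleton M := Module.length_eq_zero_iff.1 (nonpos_iff_eq_zero.1 (by simpa using hn))
      exact (addClosure_iff (M := M)).2 ⟨0, 0, 0, Subsingleton.elim _ _⟩
    | succ n ih =>
      intro M hM hn
      by_cases h0 : Limits.IsZero M
      · have := ModuleCat.isZero_iff_subsingleton.1 h0
        exact (addClosure_iff (M := M)).2 ⟨0, 0, 0, Subsingleton.elim _ _⟩
      by_cases hi : Indecomposable M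
      · exact hT M hM hi
      obtain ⟨Y, Z, e, hY, hZ⟩ : ∃ (Y Z : ModuleCat.{u} S) (_ : M ≅ Y ⊞ Z),
          ¬ Limits.IsZero Y ∧ ¬ Limits.IsZero Z := by
        by_contra! hc
        exact hi ⟨h0, fun Y Z e => or_iff_not_imp_left.2 fun hY => hc Y Z e hY⟩
      rw [ModuleCat.isZero_iff_subsingleton, not_subsingleton_iff_nontrivial,
        ← Module.length_pos_iff (R := S)] at hY hZ
      let e' := e ≪≫ ModuleCat.biprodIsoProd Y Z
      have hlen : Module.length S Y + Module.length S Z ≤ n + 1 := by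
        rw [← Module.length_prod, ← e'.toLinearEquiv.length_eq]
        exact_mod_cast hn
      have hle : ∀ a b : ℕ∞, 0 < b → a + b ≤ n + 1 → a ≤ n := fun a b hb hab =>
        (ENat.add_le_add_iff_right ENat.one_ne_top).1
          ((add_le_add_right (Order.one_le_iff_pos.2 hb) a).trans hab)
      have rY : Retract Y (Y ⊞ Z) := ⟨Limits.biprod.inl, Limits.biprod.fst, by simp⟩
      have rZ : Retract Z (Y ⊞ Z) := ⟨Limits.biprod.inr, Limits.biprod.snd, by simp⟩
      refine addClosure_of_iso e'.symm (addClosure_prod (M := Y) (N := Z) (ih _ ?_ ?_) (ih _ ?_ ?_))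
      · exact hX.of_retract (rY.trans e.symm.retract) hM
      · exact hle _ _ hZ hlen
      · exact hX.of_retract (rZ.trans e.symm.retract) hM
      · exact hle _ _ hY (by rwa [add_comm])
  intro M hM
  obtain ⟨n, hn⟩ := ENat.ne_top_iff_exists.1 (hl M hM)
  exact key n M hM hn.symm.le

/-- The direct sum of the finitely many indecomposable objects of `X` is a representation
generator. -/
theorem exists_isRepresentationGenerator [IsArtinianRing S] {X : ObjectProperty (ModuleCat.{u} S)}
    (hX : IsResolving X) (hfin : IsRepresentationFinite X) :
    ∃ T : ModuleCat.{u} S, IsRepresentationGenerator X T := by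
  classical
  obtain ⟨n, M, hM⟩ := hfin.finite_indecomposables
  -- the list `M` may contain modules outside `X`; these are replaced by zero
  let M' (i : Fin n) : ModuleCat.{u} S := if X (M i) then M i else ModuleCat.of S PUnit
  have hM' (i : Fin n) : X (M' i) := by
    dsimp only [M']
    split_ifs with h
    · exact h
    · exact hX.proj
  let T : ModuleCat.{u} S := ModuleCat.of S (∀ i, M' i)
  have hXT : X T := hX.pi n (fun i => M' i) hM'
  have := hfin.closedUnderSummands
  have := hX.closedUnderIso
  refine ⟨T, le_antisymm (le_addClosure_of_indecomposable hfin.closedUnderSummands ?_ ?_) ?_⟩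
  · intro N hN
    have : Module.Finite S N := hX.le_isFG _ hN
    exact Module.length_ne_top
  · intro N hN hi
    obtain ⟨i, ⟨e⟩⟩ := hM N hN hi
    have hi : X (M i) := X.prop_of_iso e hN
    refine addClosure_of_iso (A := M' i) (eqToIso (if_pos hi) ≪≫ e.symm) ?_
    refine (addClosure_iff (M := M' i)).2 ⟨1, LinearMap.pi fun _ => LinearMap.single S (fun i => M' i) i,
      LinearMap.proj i ∘ₗ LinearMap.proj 0, ?_⟩
    exact LinearMap.proj_comp_single_same S (fun i => M' i) i
  · rintro N ⟨m, ⟨r⟩⟩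
    exact X.prop_of_retract r (hX.pi m (fun _ => T) fun _ => hXT)

end Generators

/-! ### Global dimension of the Auslander algebra -/

section Main

theorem isSemisimpleRing_of_projective {S : Type u} [Ring S]
    (h : ∀ (M : Type u) [AddCommGroup M] [Module S M], Module.Projective S M) :
    IsSemisimpleRing S := by
  refine (isSemisimpleModule_iff S S).2 ⟨fun I => ?_⟩
  have := h (S ⧸ I)
  obtain ⟨s, hs⟩ := Module.projective_lifting_property I.mkQ LinearMap.id I.mkQ_surjective
  let f : S →ₗ[S] I := (LinearMap.id - s ∘ₗ I.mkQ).codRestrict I fun x => by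
    have h1 : I.mkQ (s (I.mkQ x)) = I.mkQ x := congr($hs (I.mkQ x))
    rw [← Submodule.Quotient.mk_eq_zero, ← Submodule.mkQ_apply]
    simp only [LinearMap.sub_apply, LinearMap.id_apply, LinearMap.comp_apply, map_sub, h1, sub_self]
  -- `f` is a projection onto `I`
  refine ⟨LinearMap.ker f, LinearMap.isCompl_of_proj fun x => Subtype.ext ?_⟩
  have h1 : I.mkQ x = 0 := (Submodule.Quotient.mk_eq_zero _).2 x.2
  simp only [f, LinearMap.codRestrict_apply, LinearMap.sub_apply, LinearMap.id_apply,
    LinearMap.comp_apply, h1, map_zero, sub_zero]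

theorem globalDim_eq_zero_iff (Λ : Type u) [Ring Λ] : globalDim Λ = 0 ↔ IsSemisimpleRing Λ := by
  rw [← isSemisimpleRing_mulOpposite_iff, ← nonpos_iff_eq_zero, ← Nat.cast_zero,
    globalDim_le_iff]
  constructor
  · exact fun h => isSemisimpleRing_of_projective fun M _ _ =>
      hasProjectiveDimensionLT_one_iff.1 (h (ModuleCat.of _ M))
  · exact fun h M => (hasProjectiveDimensionLT_one_iff (M := M)).2
      (Module.projective_of_isSemisimpleRing _ _)

theorem enat_le_of_forall_natCast {a b : ℕ∞} (h : ∀ n : ℕ, b ≤ n → a ≤ n) : a ≤ b := by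
  cases b using ENat.recTopCoe with
  | top => exact le_top
  | coe n => exact h n le_rfl

/-- Resolution dimensions at most `n` are witnessed by resolutions of length exactly `n`. -/
theorem IsResolving.resDimMod_le_iff {S : Type u} [Ring S]
    {X : ObjectProperty (ModuleCat.{u} S)} {T : ModuleCat.{u} S}
    (hX : IsResolving X) (hT : IsRepresentationGenerator X T)
    [IsNoetherianRing S] (hN : IsHomNoetherian S T) (n : ℕ) :
    resDimMod X ≤ n ↔ ∀ (M : Type u) [AddCommGroup M] [Module S M], Module.Finite S M →
      HasResolution X n (ModuleCat.of S M) := by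
  rw [resDimMod, iSup_le_iff]
  constructor
  · intro h M _ _ hM
    -- the strict bound `n + 1` yields an actual resolution, of length possibly less than `n`
    have h' := Order.lt_add_one_iff_of_not_isMax (by simp) |>.2 (h ⟨ModuleCat.of S M, hM⟩)
    obtain ⟨_, ⟨k, rfl, hk⟩, hkn⟩ := sInf_lt_iff.1 h'
    have hkn : k < n + 1 := by exact_mod_cast hkn
    rw [hX.hasResolution_iff hT hN] at hk ⊢
    exact hasProjectiveDimensionLT_of_ge _ (k + 1) _ (by omega)
  · intro h A
    exact sInf_le ⟨n, rfl, h A.obj A.property⟩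

theorem IsResolving.eq_projFG_of_isSemisimpleRing {S : Type u} [Ring S]
    {X : ObjectProperty (ModuleCat.{u} S)} (hX : IsResolving X) (h : IsSemisimpleRing S) :
    X = projFG S :=
  le_antisymm (fun M hM => ⟨hX.le_isFG _ hM, Module.projective_of_isSemisimpleRing _ M⟩) hX.proj_le

variable {Λ : Type u} [Ring Λ] [IsNoetherianRing Λᵐᵒᵖ] {X : ObjectProperty (ModuleCat.{u} Λᵐᵒᵖ)}
  {T : ModuleCat.{u} Λᵐᵒᵖ}

theorem IsResolving.resDimMod_le_globalDim (hX : IsResolving X)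
    (hT : IsRepresentationGenerator X T) (hN : IsHomNoetherian Λᵐᵒᵖ T) :
    resDimMod X ≤ globalDim (AuslanderAlgebra T) :=
  enat_le_of_forall_natCast fun n h => (hX.resDimMod_le_iff hT hN n).2 fun _ _ _ _ =>
    (hX.hasResolution_iff hT hN n).2 ((globalDim_le_iff _ n).1 h _)

theorem IsResolving.resDimMod_eq_globalDim (hX : IsResolving X)
    (hT : IsRepresentationGenerator X T) (hN : IsHomNoetherian Λᵐᵒᵖ T)
    (hproj : X = projFG Λᵐᵒᵖ) : resDimMod X = globalDim Λ := by
  refine le_antisymm (enat_le_of_forall_natCast fun n h => ?_)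
    (enat_le_of_forall_natCast fun n h => ?_)
  · refine (hX.resDimMod_le_iff hT hN n).2 fun M _ _ _ => ?_
    rw [hproj, hasResolution_projFG_iff]
    exact (globalDim_le_iff Λ n).1 h _
  · refine globalDim_le_of_finite Λ n fun M hM => (hasResolution_projFG_iff (M := M) n).1 ?_
    rw [← hproj]
    exact (hX.resDimMod_le_iff hT hN n).1 h M hM

theorem IsResolving.globalDim_eq_of_projective (hX : IsResolving X)
    (hT : IsRepresentationGenerator X T) (hN : IsHomNoetherian Λᵐᵒᵖ T)
    (hproj : X = projFG Λᵐᵒᵖ) : globalDim (AuslanderAlgebra T) = globalDim Λ := by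
  rw [← hX.resDimMod_eq_globalDim hT hN hproj]
  refine le_antisymm (enat_le_of_forall_natCast fun n h => ?_) (hX.resDimMod_le_globalDim hT hN)
  have : Module.Projective Λᵐᵒᵖ (Fin 1 → T) := (hproj ▸ hT.pi 1).2
  have : Module.Projective Λᵐᵒᵖ T := .of_equiv (LinearEquiv.funUnique (Fin 1) Λᵐᵒᵖ T)
  exact globalDim_le_of_finite _ n fun F _ =>
    hX.hasProjectiveDimensionLT_of_projective hT hN n ((hX.resDimMod_le_iff hT hN n).1 h) F

/-- For `X ≠ proj`, the bound `2` comes from the failure of the Auslander algebra to be hereditary,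
and from its finitely generated modules having second syzygies of the form `Hom(T, K)`. -/
theorem IsResolving.globalDim_eq_max (hX : IsResolving X)
    (hT : IsRepresentationGenerator X T) (hN : IsHomNoetherian Λᵐᵒᵖ T)
    (hproj : X ≠ projFG Λᵐᵒᵖ) : globalDim (AuslanderAlgebra T) = max 2 (resDimMod X) := by
  refine le_antisymm (enat_le_of_forall_natCast fun n h => ?_)
    (max_le (enat_le_of_forall_natCast fun n h => ?_) (hX.resDimMod_le_globalDim hT hN))
  · obtain ⟨h2, h⟩ := max_le_iff.1 h
    obtain ⟨m, rfl⟩ := Nat.exists_eq_add_of_le' (show 2 ≤ n by exact_mod_cast h2)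
    exact globalDim_le_of_finite _ _ fun F _ =>
      hX.hasProjectiveDimensionLT_add_three hT hN m ((hX.resDimMod_le_iff hT hN _).1 h) F
  · by_contra hn
    have hn : n ≤ 1 := by
      have : ¬ 2 ≤ n := fun h => hn (by exact_mod_cast h)
      omega
    have hF := (globalDim_le_iff _ 1).1 (h.trans (Nat.cast_le.2 hn))
    exact hproj <| le_antisymm (fun M hM => ⟨hX.le_isFG _ hM,
      hX.projective_of_hasProjectiveDimensionLT_two hT hF (M := M) hM⟩) hX.proj_le

end Main
end RelAuslander

theorem proposition6p4 (R : Type w) [CommRing R] [IsArtinianRing R]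
    (Λ : Type u) [Ring Λ] [Algebra R Λ] [Module.Finite R Λ]
    (X : ObjectProperty (ModuleCat.{u} Λᵐᵒᵖ))
    (hX : RelAuslander.IsResolving X) (hfin : RelAuslander.IsRepresentationFinite X) :
    (∃ T : ModuleCat.{u} Λᵐᵒᵖ, RelAuslander.IsRepresentationGenerator X T) ∧
    ∀ T : ModuleCat.{u} Λᵐᵒᵖ, RelAuslander.IsRepresentationGenerator X T →
      (RelAuslander.globalDim (RelAuslander.AuslanderAlgebra T) = 0 ↔ IsSemisimpleRing Λ) ∧
      (IsSemisimpleRing Λ → X = RelAuslander.projFG Λᵐᵒᵖ) ∧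
      (RelAuslander.globalDim (RelAuslander.AuslanderAlgebra T) = 1 ↔
        RelAuslander.globalDim Λ = 1 ∧ X = RelAuslander.projFG Λᵐᵒᵖ) ∧
      (RelAuslander.globalDim (RelAuslander.AuslanderAlgebra T) = 2 ↔
        (X = RelAuslander.projFG Λᵐᵒᵖ ∧ RelAuslander.globalDim Λ = 2) ∨
        (X ≠ RelAuslander.projFG Λᵐᵒᵖ ∧ RelAuslander.resDimMod X ≤ 2)) ∧
      (3 ≤ RelAuslander.resDimMod X →
        RelAuslander.globalDim (RelAuslander.AuslanderAlgebra T) = RelAuslander.resDimMod X) ∧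
      (X = RelAuslander.projFG Λᵐᵒᵖ →
        RelAuslander.globalDim (RelAuslander.AuslanderAlgebra T) = RelAuslander.globalDim Λ) ∧
      (X ≠ RelAuslander.projFG Λᵐᵒᵖ →
        RelAuslander.globalDim (RelAuslander.AuslanderAlgebra T) =
          max 2 (RelAuslander.resDimMod X)) := by
  have : IsNoetherianRing Λᵐᵒᵖ := .of_finite R Λᵐᵒᵖ
  have : IsArtinianRing Λᵐᵒᵖ := .of_finite R Λᵐᵒᵖ
  refine ⟨RelAuslander.exists_isRepresentationGenerator hX hfin, fun T hT => ?_⟩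
  have := hT.finite hX
  have hN : RelAuslander.IsHomNoetherian Λᵐᵒᵖ T := RelAuslander.isHomNoetherian_of_algebra R
  have hproj := hX.globalDim_eq_of_projective hT hN
  have hmax := hX.globalDim_eq_max hT hN
  have hres := hX.resDimMod_eq_globalDim hT hN
  have hss : IsSemisimpleRing Λ → X = RelAuslander.projFG Λᵐᵒᵖ := fun _ =>
    hX.eq_projFG_of_isSemisimpleRing inferInstance
  have hzero := RelAuslander.globalDim_eq_zero_iff Λ
  have h2 : ¬ (2 : ℕ∞) ≤ 1 := by decide
  by_cases hP : X = RelAuslander.projFG Λᵐᵒᵖ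
  · rw [hproj hP]
    refine ⟨hzero, hss, by simp [hP], by simp [hP], fun _ => (hres hP).symm, fun _ => rfl,
      fun h => absurd hP h⟩
  · rw [hmax hP]
    refine ⟨⟨fun h => ?_, fun h => absurd (hss h) hP⟩, hss, ⟨fun h => ?_, fun h => absurd h.2 hP⟩,
      by simp [hP], fun h => ?_, fun h => absurd h hP, fun _ => rfl⟩
    · exact absurd ((le_max_left _ _).trans h.le) (by decide)
    · exact absurd ((le_max_left _ _).trans h.le) h2
    · exact max_eq_right (le_trans (by decide) h)
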